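/- All semigroups below are nonempty, and $\mathbf{PV}$ denotes the complete lattice (ordered by inclusion) of pseudovarieties of finite semigroups, i.e. classes of finite semigroups closed under subsemigroups, homomorphic images and finite direct products (including the empty product). For a finite semigroup $T$, let $(T)\in\mathbf{PV}$ be the pseudovariety generated by $T$. A finite semigroup $T$ *lifts* if for every surjective homomorphism $S\twoheadrightarrow T$ with $S$ a finite semigroup, some subsemigroup of $S$ is isomorphic to $T$. A finite nontrivial semigroup $T$ (or the pseudovariety $(T)$) is *very small* if for every finite semigroup $S$ the join $(S)\vee(T)$ equals or covers $(S)$ in $\mathbf{PV}$. A *relational morphism* $f\colon S\to T$ is a map $s\mapsto sf$ assigning to each $s\in S$ a nonempty subset $sf\subseteq T$, with $(s_1f)(s_2f)\subseteq (s_1s_2)f$ for all $s_1,s_2\in S$; for $W\subseteq T$ put $Wf^{-1}=\{s\in S\mid sf\cap W\neq\emptyset\}$. Let $\mathbf{GMC}(\mathbf{PV})$ be the set of all operators $\alpha\colon\mathbf{PV}\to\mathbf{PV}$ that are continuous (order preserving and commuting with directed joins) and satisfy the generalized Mal'cev condition: whenever $\mathbf V\in\mathbf{PV}$ and $S\in\alpha(\mathbf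 V)$, there is a relational morphism $f\colon S\to T$ with $T\in\mathbf V$ such that $Wf^{-1}\in\alpha((W))$ for every subsemigroup $W\leq T$ with $Wf^{-1}\neq\emptyset$. Let $\mathbf{GMC}^+(\mathbf{PV})$ be the set of those $\alpha\in\mathbf{GMC}(\mathbf{PV})$ with $\mathbf V\leq\alpha(\mathbf V)$ for all $\mathbf V\in\mathbf{PV}$, ordered pointwise; its least element is the identity operator $1_{\mathbf{PV}}$. **Proposition.** Let $a$ be (up to isomorphism) one of the following finite semigroups: the two-element right zero semigroup $\mathbf 2^r$, the two-element left zero semigroup $\mathbf 2^l$, the two-element null semigroup $N_2$, the two-element semilattice $\{0,1\}$ under multiplication, or the cyclic group $\mathbb Z_p$ with $p$ prime. If $a$ lifts and $(a)$ is very small, then the operator $\mathbf V\mapsto\mathbf V\vee(a)$ belongs to $\mathbf{GMC}^+(\mathbf{PV})$ and is an atom of it, i.e. it is a minimal element of $\mathbf{GMC}^+(\mathbf{PV})\setminus\{1_{\mathbf{PV}}\}$. -/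

import Mathlib

/-- A finite (nonempty) semigroup. -/
structure FinSgp : Type 1 where
  carrier : Type
  [semigroup : Semigroup carrier]
  [finite : Finite carrier]
  [nonempty : Nonempty carrier]

namespace FinSgp

instance : CoeSort FinSgp Type := ⟨FinSgp.carrier⟩

attribute [instance] FinSgp.semigroup FinSgp.finite FinSgp.nonempty

/-- The bundled finite semigroup on a type. -/
abbrev of (S : Type) [Semigroup S] [Finite S] [Nonempty S] : FinSgp := ⟨S⟩

/-- The two-element right zero semigroup `2^r`. -/
def rightZeroTwo : FinSgp where
  carrier := Bool
  semigroup := { mul := fun _ y => y, mul_assoc := fun _ _ _ => rfl }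

/-- The two-element left zero semigroup `2^l`. -/
def leftZeroTwo : FinSgp where
  carrier := Bool
  semigroup := { mul := fun x _ => x, mul_assoc := fun _ _ _ => rfl }

/-- The two-element null semigroup `N₂`; the zero is `false`. -/
def nullTwo : FinSgp where
  carrier := Bool
  semigroup := { mul := fun _ _ => false, mul_assoc := fun _ _ _ => rfl }

/-- The two-element semilattice `{0,1}` under multiplication (`0` is `false`, `1` is `true`). -/
def semilatticeTwo : FinSgp where
  carrier := Bool
  semigroup := { mul := fun x y => x && y, mul_assoc := Bool.and_assoc }

/-- The cyclic group `ℤ_p` of prime order, as a semigroup. -/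
def cyclic (p : ℕ) [Fact p.Prime] : FinSgp := of (Multiplicative (ZMod p))

/-- `a` is (isomorphic to) one of `2^r`, `2^l`, `N₂`, `{0,1}`, or `ℤ_p` with `p` prime. -/
def IsStandardAtom (a : FinSgp) : Prop :=
  Nonempty (a ≃* rightZeroTwo) ∨ Nonempty (a ≃* leftZeroTwo) ∨ Nonempty (a ≃* nullTwo) ∨
    Nonempty (a ≃* semilatticeTwo) ∨ ∃ (p : ℕ) (_ : Fact p.Prime), Nonempty (a ≃* cyclic p)

/-- `T` lifts: whenever a finite semigroup `S` maps homomorphically onto `T`, some subsemigroup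
of `S` is isomorphic to `T`. -/
def Lifts (T : FinSgp) : Prop :=
  ∀ (S : FinSgp) (φ : S →ₙ* T), Function.Surjective φ →
    ∃ T' : Subsemigroup S, Nonempty (T ≃* T')

end FinSgp

/-- A pseudovariety of finite semigroups: a class of finite semigroups closed under finite direct
products (including the empty one), subsemigroups and homomorphic images. -/
@[ext]
structure Pseudovariety : Type 1 where
  carrier : Set FinSgp
  one_mem : FinSgp.of Unit ∈ carrier
  prod_mem : ∀ {S T : FinSgp}, S ∈ carrier → T ∈ carrier → FinSgp.of (S × T) ∈ carrier
  sub_mem : ∀ {S T : FinSgp} (φ : S →ₙ* T), Function.Injective φ → T ∈ carrier → S ∈ carrier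
  quot_mem : ∀ {S T : FinSgp} (φ : S →ₙ* T), Function.Surjective φ → S ∈ carrier → T ∈ carrier

namespace Pseudovariety

instance : SetLike Pseudovariety FinSgp where
  coe := carrier
  coe_injective _ _ h := Pseudovariety.ext h

/-- Pseudovarieties are ordered by inclusion. -/
instance : PartialOrder Pseudovariety := PartialOrder.ofSetLike Pseudovariety FinSgp

/-- Meets are intersections. -/
instance : InfSet Pseudovariety where
  sInf 𝒱 :=
    { carrier := {S | ∀ V ∈ 𝒱, S ∈ V}
      one_mem := fun V _ => V.one_mem
      prod_mem := fun hS hT V hV => V.prod_mem (hS V hV) (hT V hV)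
      sub_mem := fun φ hφ hT V hV => V.sub_mem φ hφ (hT V hV)
      quot_mem := fun φ hφ hS V hV => V.quot_mem φ hφ (hS V hV) }

theorem isGLB_sInf (𝒱 : Set Pseudovariety) : IsGLB 𝒱 (sInf 𝒱) :=
  ⟨fun _ hV _ hS => hS _ hV, fun _ hW _ hS _ hV => hW hV hS⟩

/-- The complete lattice `PV` of pseudovarieties of finite semigroups. -/
instance : CompleteLattice Pseudovariety :=
  completeLatticeOfInf Pseudovariety isGLB_sInf

/-- The pseudovariety `(T)` generated by a finite semigroup `T`. -/
def gen (T : FinSgp) : Pseudovariety := sInf {V | T ∈ V}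

end Pseudovariety

/-- `(T)` is very small: `T` is nontrivial and, for every finite semigroup `S`, the join
`(S) ∨ (T)` equals or covers `(S)`. -/
def FinSgp.VerySmall (T : FinSgp) : Prop :=
  Nontrivial T ∧ ∀ S : FinSgp,
    Pseudovariety.gen S ⊔ Pseudovariety.gen T = Pseudovariety.gen S ∨
      Pseudovariety.gen S ⋖ Pseudovariety.gen S ⊔ Pseudovariety.gen T

/-- A relational morphism of semigroups `S → T`. -/
structure RelMorphism (S T : Type) [Semigroup S] [Semigroup T] where
  toFun : S → Set T
  nonempty : ∀ s, (toFun s).Nonempty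
  mul_mem : ∀ {s₁ s₂ : S} {t₁ t₂ : T}, t₁ ∈ toFun s₁ → t₂ ∈ toFun s₂ →
    t₁ * t₂ ∈ toFun (s₁ * s₂)

/-- The inverse image `W f⁻¹ = {s | sf ∩ W ≠ ∅}` of a subsemigroup under a relational morphism. -/
def RelMorphism.inv {S T : Type} [Semigroup S] [Semigroup T] (f : RelMorphism S T)
    (W : Subsemigroup T) : Subsemigroup S where
  carrier := {s | ∃ t ∈ f.toFun s, t ∈ W}
  mul_mem' := by
    rintro a b ⟨t, ht, htW⟩ ⟨u, hu, huW⟩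
    exact ⟨t * u, f.mul_mem ht hu, W.mul_mem htW huW⟩

/-- The generalized Mal'cev condition for an operator on `PV`: every `S ∈ α(V)` admits a relational
morphism `f : S → T` with `T ∈ V` such that `W f⁻¹ ∈ α((W))` for all subsemigroups `W ≤ T`.
(Only nonempty `W` and `W f⁻¹` are finite semigroups in the sense above.) -/
def GenMalcev (α : Pseudovariety → Pseudovariety) : Prop :=
  ∀ (V : Pseudovariety) (S : FinSgp), S ∈ α V →
    ∃ T ∈ V, ∃ f : RelMorphism S T, ∀ (W : Subsemigroup T) [Nonempty W] [Nonempty (f.inv W)],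
      FinSgp.of (f.inv W) ∈ α (Pseudovariety.gen (FinSgp.of W))

/-- `GMC(PV)`: the continuous operators on `PV` (order preserving and commuting with directed
joins) that satisfy the generalized Mal'cev condition. -/
def GMC : Set (Pseudovariety → Pseudovariety) :=
  {α | ScottContinuous α ∧ GenMalcev α}

/-- `GMC⁺(PV)`: the members `α` of `GMC(PV)` with `V ≤ α(V)` for all `V`. As a type it carries
the pointwise order. -/
def GMCPlus : Set (Pseudovariety → Pseudovariety) :=
  {α | α ∈ GMC ∧ ∀ V, V ≤ α V}

theorem id_mem_GMCPlus : (id : Pseudovariety → Pseudovariety) ∈ GMCPlus := by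
  refine ⟨⟨ScottContinuous.id, ?_⟩, fun V => le_rfl⟩
  intro V S hS
  refine ⟨S, hS, ⟨fun s => {s}, fun s => Set.singleton_nonempty s, ?_⟩, ?_⟩
  · rintro s₁ s₂ t₁ t₂ rfl rfl
    rfl
  · intro W _ _ V' hV'
    refine V'.sub_mem (T := FinSgp.of W)
      ⟨fun x => ⟨x.1, ?_⟩, fun _ _ => rfl⟩ ?_ hV'
    · obtain ⟨t, rfl, htW⟩ := x.2
      exact htW
    · intro x y h
      exact Subtype.ext (congrArg (fun z : W => z.1) h)

/-- The bottom of `GMC⁺(PV)` is the identity operator. -/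
instance : OrderBot GMCPlus where
  bot := ⟨id, id_mem_GMCPlus⟩
  bot_le α := fun V => α.2.2 V

/-! For any `U`, each member of `V ⊔ U` is a quotient of some `R ≤ T × A` with `T ∈ V` and `A ∈ U`.
Reading `R` as a relation to `T` gives the generalized Mal'cev condition, since restricting `R` to
`W ≤ T` keeps it inside `W × A`.

For minimality, let `β ≠ id` lie below joining with `gen a`. The Mal'cev condition makes `β` enlarge
some `gen T`. As `gen T ⊔ gen a` covers `gen T`, it equals `β (gen T)`, which thus contains `a`,
while `a ∉ gen T`. The condition now relates `a` to some `T' ∈ gen T`. As `a` lifts, the graph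
contains a copy of `a`, whose projection to `T'` cannot be injective and so is constant, with an
idempotent value `e` related to all of `a`. Hence `a ∈ β (gen {e}) ≤ β V` for every `V`. -/

namespace FinSgp

/-- A non-injective homomorphism out of a two-element semigroup or a cyclic group of prime order
is constant. -/
theorem IsStandardAtom.injective_or_constant {a : FinSgp} (ha : a.IsStandardAtom) {T : FinSgp}
    (h : a →ₙ* T) : Function.Injective h ∨ ∀ x y, h x = h y := by
  by_cases hinj : Function.Injective h
  · exact Or.inl hinj
  right
  simp only [Function.Injective, not_forall] at hinj
  obtain ⟨x, y, hxy, hne⟩ := hinj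
  have two (e : a ≃ Bool) (u v : a) : h u = h v := by
    have key (w : a) : w = x ∨ w = y := by
      have h1 : e x ≠ e y := e.injective.ne hne
      rcases hw : e w <;> rcases hx : e x <;> rcases hy : e y <;> rw [hx, hy] at h1 <;>
        first
        | exact absurd rfl h1
        | exact Or.inl (e.injective (hw.trans hx.symm))
        | exact Or.inr (e.injective (hw.trans hy.symm))
    rcases key u with rfl | rfl <;> rcases key v with rfl | rfl <;> simp [hxy]
  rcases ha with ⟨⟨e⟩⟩ | ⟨⟨e⟩⟩ | ⟨⟨e⟩⟩ | ⟨⟨e⟩⟩ | ⟨p, hp, ⟨e⟩⟩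
  · exact two e.toEquiv
  · exact two e.toEquiv
  · exact two e.toEquiv
  · exact two e.toEquiv
  · let k : Multiplicative (ZMod p) →ₙ* T := h.comp e.symm.toMulHom
    let e' : a ≃* Multiplicative (ZMod p) := e
    have hk (u : a) : k (e' u) = h u := congrArg h (e.symm_apply_apply u)
    -- `k` is invariant under right translation by this nontrivial element, which generates the
    -- group because the order is prime.
    have hg : (e' y)⁻¹ * e' x ≠ 1 := fun h1 =>
      hne (e'.injective (inv_mul_eq_one.mp h1).symm)
    have step (z : Multiplicative (ZMod p)) : k (z * ((e' y)⁻¹ * e' x)) = k z := by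
      rw [← mul_assoc, map_mul, hk, hxy, ← hk y, ← map_mul, inv_mul_cancel_right]
    have steps (z : Multiplicative (ZMod p)) (n : ℕ) :
        k (z * ((e' y)⁻¹ * e' x) ^ n) = k z := by
      induction n with
      | zero => simp
      | succ n ih => rw [pow_succ, ← mul_assoc, step, ih]
    intro u v
    have hcard : Nat.card (Multiplicative (ZMod p)) = p := by simp
    obtain ⟨n, hn⟩ := mem_powers_of_prime_card (g' := (e' u)⁻¹ * e' v) hcard hg
    rw [← hk u, ← hk v, ← steps (e' u) n]
    simp only at hn
    rw [hn, mul_inv_cancel_left]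

end FinSgp

namespace Pseudovariety

theorem mem_gen (T : FinSgp) : T ∈ gen T := fun _ hV => hV

theorem gen_le {T : FinSgp} {V : Pseudovariety} : gen T ≤ V ↔ T ∈ V :=
  ⟨fun h => h (mem_gen T), fun h _ hS => hS V h⟩

theorem mem_of_subsingleton (V : Pseudovariety) (S : FinSgp) [Subsingleton S] : S ∈ V :=
  V.sub_mem (T := FinSgp.of Unit) ⟨fun _ => (), fun _ _ => rfl⟩
    (fun _ _ _ => Subsingleton.elim _ _) V.one_mem

/-- The pseudovariety of one-element semigroups. -/
def trivialSemigroups : Pseudovariety where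
  carrier := {S | Subsingleton S}
  one_mem := inferInstanceAs (Subsingleton Unit)
  prod_mem := fun {S T} (_ : Subsingleton S) (_ : Subsingleton T) =>
    inferInstanceAs (Subsingleton (S × T))
  sub_mem := fun _ hφ (_ : Subsingleton _) => hφ.subsingleton
  quot_mem := fun _ hφ (_ : Subsingleton _) => hφ.subsingleton

/-- `S` is a homomorphic image of a subdirect product of a member of `V` and a member of `U`. -/
def IsJoinDivisor (V U : Pseudovariety) (S : FinSgp) : Prop :=
  ∃ T ∈ V, ∃ A ∈ U, ∃ (R : FinSgp) (p : R →ₙ* T) (q : R →ₙ* A) (φ : R →ₙ* S),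
    (∀ x y, p x = p y → q x = q y → x = y) ∧ Function.Surjective φ

/-- The pseudovariety of divisors of products `T × A` with `T ∈ V` and `A ∈ U`. -/
def joinDivisors (V U : Pseudovariety) : Pseudovariety where
  carrier := {S | IsJoinDivisor V U S}
  one_mem := ⟨_, V.one_mem, _, U.one_mem, FinSgp.of Unit, MulHom.id _, MulHom.id _, MulHom.id _,
    fun _ _ _ _ => rfl, fun x => ⟨x, rfl⟩⟩
  prod_mem := by
    rintro S S' ⟨T, hT, A, hA, R, p, q, φ, hi, hs⟩ ⟨T', hT', A', hA', R', p', q', φ', hi', hs'⟩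
    refine ⟨_, V.prod_mem hT hT', _, U.prod_mem hA hA', FinSgp.of (R × R'), p.prodMap p',
      q.prodMap q', φ.prodMap φ', ?_, hs.prodMap hs'⟩
    rintro ⟨x, x'⟩ ⟨y, y'⟩ h1 h2
    exact Prod.ext (hi _ _ (congrArg Prod.fst h1) (congrArg Prod.fst h2))
      (hi' _ _ (congrArg Prod.snd h1) (congrArg Prod.snd h2))
  sub_mem := by
    rintro S S' ψ hψ ⟨T, hT, A, hA, R, p, q, φ, hi, hs⟩
    -- The pullback of `φ` along `ψ`; as `ψ` is injective, it still embeds in `T × A`.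
    let P : Subsemigroup (R × S) :=
      { carrier := {x | φ x.1 = ψ x.2}
        mul_mem' := fun {x y} (hx : φ x.1 = ψ x.2) (hy : φ y.1 = ψ y.2) =>
          show φ (x.1 * y.1) = ψ (x.2 * y.2) by rw [map_mul, map_mul, hx, hy] }
    have hsurj (s : S) : ∃ r : R, (r, s) ∈ P := hs (ψ s)
    obtain ⟨s₀⟩ := S.nonempty
    obtain ⟨r₀, h₀⟩ := hsurj s₀
    have : Nonempty P := ⟨⟨_, h₀⟩⟩
    refine ⟨T, hT, A, hA, FinSgp.of P, p.comp ((MulHom.fst R S).comp (MulMemClass.subtype P)),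
      q.comp ((MulHom.fst R S).comp (MulMemClass.subtype P)),
      (MulHom.snd R S).comp (MulMemClass.subtype P), ?_, ?_⟩
    · rintro ⟨⟨x, s⟩, hx : φ x = ψ s⟩ ⟨⟨y, t⟩, hy : φ y = ψ t⟩ h1 h2
      obtain rfl : x = y := hi _ _ h1 h2
      obtain rfl : s = t := hψ (hx.symm.trans hy)
      rfl
    · intro s
      obtain ⟨r, hr⟩ := hsurj s
      exact ⟨⟨(r, s), hr⟩, rfl⟩
  quot_mem := by
    rintro S S' ψ hψ ⟨T, hT, A, hA, R, p, q, φ, hi, hs⟩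
    exact ⟨T, hT, A, hA, R, p, q, ψ.comp φ, hi, hψ.comp hs⟩

/-- The divisors of products form a pseudovariety containing `V` and `U`: take the other factor to
be the one-element semigroup. -/
theorem isJoinDivisor_of_mem_sup {V U : Pseudovariety} {S : FinSgp} (hS : S ∈ V ⊔ U) :
    IsJoinDivisor V U S := by
  have h : V ⊔ U ≤ joinDivisors V U := sup_le
    (fun T hT => ⟨T, hT, _, U.one_mem, T, MulHom.id _, ⟨fun _ => (), fun _ _ => rfl⟩, MulHom.id _,
      fun _ _ h _ => h, fun x => ⟨x, rfl⟩⟩)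
    (fun A hA => ⟨_, V.one_mem, A, hA, A, ⟨fun _ => (), fun _ _ => rfl⟩, MulHom.id _, MulHom.id _,
      fun _ _ _ h => h, fun x => ⟨x, rfl⟩⟩)
  exact h hS

theorem mem_sup_of_isJoinDivisor {V U : Pseudovariety} {S : FinSgp} (hS : IsJoinDivisor V U S) :
    S ∈ V ⊔ U := by
  obtain ⟨T, hT, A, hA, R, p, q, φ, hi, hs⟩ := hS
  have hTA : FinSgp.of (T × A) ∈ V ⊔ U :=
    (V ⊔ U).prod_mem ((le_sup_left : V ≤ V ⊔ U) hT) ((le_sup_right : U ≤ V ⊔ U) hA)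
  refine (V ⊔ U).quot_mem φ hs ((V ⊔ U).sub_mem (T := FinSgp.of (T × A)) (p.prod q) ?_ hTA)
  intro x y h
  exact hi x y (congrArg Prod.fst h) (congrArg Prod.snd h)

theorem genMalcev_sup (U : Pseudovariety) : GenMalcev (fun V => V ⊔ U) := by
  intro V S hS
  obtain ⟨T, hT, A, hA, R, p, q, φ, hi, hs⟩ := isJoinDivisor_of_mem_sup hS
  refine ⟨T, hT, ⟨fun s => {t | ∃ r, φ r = s ∧ p r = t}, fun s => ?_, ?_⟩, ?_⟩
  · obtain ⟨r, hr⟩ := hs s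
    exact ⟨p r, r, hr, rfl⟩
  · rintro _ _ _ _ ⟨r, rfl, rfl⟩ ⟨r', rfl, rfl⟩
    exact ⟨r * r', map_mul _ _ _, map_mul _ _ _⟩
  · intro W _ hne
    obtain ⟨⟨_, _, ⟨r₀, rfl, rfl⟩, h₀⟩⟩ := hne
    let P : Subsemigroup R := W.comap p
    have : Nonempty P := ⟨⟨r₀, h₀⟩⟩
    refine mem_sup_of_isJoinDivisor ⟨FinSgp.of W, mem_gen _, A, hA, FinSgp.of P,
      ⟨fun x => ⟨p x.1, x.2⟩, fun x y => Subtype.ext (map_mul p x.1 y.1)⟩,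
      q.comp (MulMemClass.subtype P),
      ⟨fun x => ⟨φ x.1, p x.1, ⟨x.1, rfl, rfl⟩, x.2⟩,
        fun x y => Subtype.ext (map_mul φ x.1 y.1)⟩, ?_, ?_⟩
    · intro x y h1 h2
      exact Subtype.ext (hi _ _ (congrArg (fun z : W => z.1) h1) h2)
    · rintro ⟨_, _, ⟨r, rfl, rfl⟩, hr⟩
      exact ⟨⟨r, hr⟩, rfl⟩

theorem scottContinuous_sup (U : Pseudovariety) :
    ScottContinuous (fun V : Pseudovariety => V ⊔ U) := by
  rintro d ⟨V₀, hV₀⟩ - V hV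
  constructor
  · rintro _ ⟨V', hV', rfl⟩
    exact sup_le_sup_right (hV.1 hV') U
  · intro B hB
    have hB' {V'} (h : V' ∈ d) : V' ⊔ U ≤ B := hB ⟨V', h, rfl⟩
    -- Nonemptiness of `d` is what gives `U ≤ B`.
    exact sup_le (hV.2 fun V' h => le_sup_left.trans (hB' h)) (le_sup_right.trans (hB' hV₀))

theorem sup_mem_GMCPlus (U : Pseudovariety) : (fun V : Pseudovariety => V ⊔ U) ∈ GMCPlus :=
  ⟨⟨scottContinuous_sup U, genMalcev_sup U⟩, fun _ => le_sup_left⟩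

end Pseudovariety

open Pseudovariety

/-- The graph of a relational morphism. -/
def RelMorphism.graph {S T : Type} [Semigroup S] [Semigroup T] (f : RelMorphism S T) :
    Subsemigroup (S × T) where
  carrier := {x | x.2 ∈ f.toFun x.1}
  mul_mem' := fun h h' => f.mul_mem h h'

/-- A relational morphism from a lifting standard atom to a semigroup whose pseudovariety omits
the atom relates all elements of the atom to one common idempotent. -/
theorem FinSgp.Lifts.exists_common_idempotent {a T : FinSgp} (hlift : a.Lifts)
    (ha : a.IsStandardAtom) (haT : a ∉ gen T) (f : RelMorphism a T) :
    ∃ e : T, e * e = e ∧ ∀ s, e ∈ f.toFun s := by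
  obtain ⟨x₀⟩ := a.nonempty
  have : Nonempty f.graph := ⟨⟨(x₀, (f.nonempty x₀).some), (f.nonempty x₀).some_mem⟩⟩
  obtain ⟨G, ⟨i⟩⟩ := hlift (FinSgp.of f.graph)
    ((MulHom.fst a T).comp (MulMemClass.subtype f.graph))
    (fun s => ⟨⟨(s, (f.nonempty s).some), (f.nonempty s).some_mem⟩, rfl⟩)
  let j : a →ₙ* a × T :=
    (MulMemClass.subtype f.graph).comp ((MulMemClass.subtype G).comp i.toMulHom)
  have hj : Function.Injective j :=
    Subtype.val_injective.comp (Subtype.val_injective.comp i.injective)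
  have hmem (x : a) : (j x).2 ∈ f.toFun (j x).1 := (i x).1.2
  let k : a →ₙ* T := (MulHom.snd a T).comp j
  have hk : ∀ x y, k x = k y := (ha.injective_or_constant k).resolve_left fun hinj =>
    haT ((gen T).sub_mem k hinj (mem_gen T))
  -- The second coordinate being constant, the first is an injective self-map of the finite `a`,
  -- hence onto.
  have hfst : Function.Injective fun x => (j x).1 := fun x y h =>
    hj (Prod.ext h (hk x y))
  refine ⟨k x₀, ?_, fun s => ?_⟩
  · rw [← map_mul]
    exact hk _ _
  · obtain ⟨x, rfl⟩ := Finite.surjective_of_injective hfst s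
    rw [hk x₀ x]
    exact hmem x

theorem GMCPlus.mem_of_ne_bot {a : FinSgp} (ha : a.IsStandardAtom) (hlift : a.Lifts)
    (hsmall : a.VerySmall) {β : Pseudovariety → Pseudovariety} (hβ : β ∈ GMCPlus)
    (hle : ∀ V, β V ≤ V ⊔ gen a) (hne : β ≠ id) (V : Pseudovariety) : a ∈ β V := by
  obtain ⟨⟨hcont, hmal⟩, hinc⟩ := hβ
  obtain ⟨V₁, hV₁⟩ : ∃ V₁, ¬ β V₁ ≤ V₁ := by
    by_contra! h
    exact hne (funext fun V => le_antisymm (h V) (hinc V))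
  obtain ⟨S, hS, hSV⟩ := SetLike.not_le_iff_exists.mp hV₁
  obtain ⟨T, hT, f, hf⟩ := hmal V₁ S hS
  -- Taking `W = ⊤` passes from `V₁` to a pseudovariety with one generator, where `VerySmall`
  -- applies.
  have hST : S ∈ β (gen T) := by
    have htop (s : S) : s ∈ f.inv ⊤ := ⟨_, (f.nonempty s).some_mem, trivial⟩
    have : Nonempty (⊤ : Subsemigroup T) := T.nonempty.map fun t => ⟨t, trivial⟩
    have : Nonempty (f.inv ⊤) := S.nonempty.map fun s => ⟨s, htop s⟩
    have hgen : gen (FinSgp.of (⊤ : Subsemigroup T)) ≤ gen T := gen_le.mpr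
      ((gen T).sub_mem (T := T) (MulMemClass.subtype _) Subtype.val_injective (mem_gen T))
    exact (β (gen T)).quot_mem (S := FinSgp.of (f.inv ⊤)) (MulMemClass.subtype _)
      (fun s => ⟨⟨s, htop s⟩, rfl⟩) (hcont.monotone hgen (hf ⊤))
  have hlt : gen T < β (gen T) := lt_of_le_of_ne (hinc _) fun h =>
    hSV (gen_le.mpr hT (h ▸ hST))
  have hcov : gen T ⋖ gen T ⊔ gen a := (hsmall.2 T).resolve_left fun h =>
    hlt.not_ge ((hle _).trans h.le)
  have haβ : a ∈ β (gen T) := by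
    have h : β (gen T) = gen T ⊔ gen a :=
      (hcov.eq_or_eq hlt.le (hle _)).resolve_left hlt.ne'
    rw [h]
    exact (le_sup_right : gen a ≤ gen T ⊔ gen a) (mem_gen a)
  have haT : a ∉ gen T := fun h => hcov.lt.ne' (sup_eq_left.mpr (gen_le.mpr h))
  obtain ⟨T', hT', f', hf'⟩ := hmal (gen T) a haβ
  obtain ⟨e, he, hes⟩ := hlift.exists_common_idempotent ha
    (fun h => haT (gen_le.mpr hT' h)) f'
  let W : Subsemigroup T' :=
    { carrier := {e}
      mul_mem' := by
        rintro _ _ rfl rfl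
        exact he }
  have hW (s : a) : s ∈ f'.inv W := ⟨e, hes s, rfl⟩
  have : Nonempty W := ⟨⟨e, rfl⟩⟩
  have : Subsingleton W := ⟨fun x y => Subtype.ext (x.2.trans y.2.symm)⟩
  have : Nonempty (f'.inv W) := a.nonempty.map fun s => ⟨s, hW s⟩
  have : Subsingleton (FinSgp.of W) := ‹Subsingleton W›
  -- `W = {e}` is trivial, so it lies in every `V`, and its inverse image is all of `a`.
  have hgen : gen (FinSgp.of W) ≤ V := gen_le.mpr (V.mem_of_subsingleton _)
  exact (β V).quot_mem (S := FinSgp.of (f'.inv W)) (MulMemClass.subtype _)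
    (fun s => ⟨⟨s, hW s⟩, rfl⟩) (hcont.monotone hgen (hf' W))

theorem mainTheorem9 (a : FinSgp) (ha : a.IsStandardAtom) (hlift : a.Lifts)
    (hsmall : a.VerySmall) :
    ∃ h : (fun V : Pseudovariety => V ⊔ Pseudovariety.gen a) ∈ GMCPlus,
      IsAtom (⟨fun V : Pseudovariety => V ⊔ Pseudovariety.gen a, h⟩ : GMCPlus) := by
  refine ⟨sup_mem_GMCPlus (gen a), ?_, ?_⟩
  · intro h
    have h1 : (⊥ : Pseudovariety) ⊔ gen a = ⊥ :=
      congrFun (congrArg (fun β : GMCPlus => β.1) h) ⊥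
    have := hsmall.1
    exact not_subsingleton a
      ((sup_eq_left.mp h1).trans (bot_le : ⊥ ≤ trivialSemigroups) (mem_gen a))
  · rintro ⟨β, hβ⟩ hlt
    by_contra hbot
    refine hlt.not_ge fun V => sup_le (hβ.2 V) (gen_le.mpr ?_)
    exact GMCPlus.mem_of_ne_bot ha hlift hsmall hβ (fun V => hlt.le V)
      (fun h => hbot (Subtype.ext h)) V
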